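/- Let $E_\rho$ be a universally complete Archimedean real vector lattice (Dedekind complete, and every nonempty set of pairwise disjoint positive elements has a supremum), equipped with a $\Phi$-algebra multiplication, i.e. an $f$-algebra multiplication with identity $e$. Let $E=E_\rho\oplus iE_\rho$ be the associated universally complete Archimedean complex vector lattice, with modulus $|f+ig|=\sup\{(\cos\theta)f+(\sin\theta)g:\theta\in[0,2\pi]\}$ and the canonically extended multiplication $(f+ig)(h+ik)=(fh-gk)+i(fk+gh)$. A sequence $(x_n)_{n\ge 0}$ in $E$ converges in order to $x\in E$ if there is a decreasing sequence $(p_n)_{n\ge 0}$ in $E_\rho$ with $\inf_n p_n=0$ and $|x_n-x|\le p_n$ for all $n$; a series converges in order if its sequence of partial sums does, its sum being the order limit, and $\sum_{n=0}^\infty a_n$ converges absolutely in order if $\sum_{n=0}^\infty|a_n|$ converges in order. A weak order unit is an element $u\ge 0$ of $E_\rho$ such that $u\wedge|x|=0$ implies $x=0$ for all $x\in E_\rho$, and for $x,y\in E_\rho$ we write $x\ll y$ if $(y-x)^+$ is a weak order unit. Let $a\in E$, and put $a^0=e$. Then the geometric series $\sum_{n=0}^{\infty}a^n$ converges absolutely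 in order if and only if $|a|\ll e$. In this case $e-a$ is invertible in $E$, the series $\sum_{n=0}^\infty a^n$ converges in order, and its unique sum is $(e-a)^{-1}$. -/

import Mathlib

/-! ### Real vector lattices

A Dedekind complete real vector lattice is given by Mathlib's mixins
`[ConditionallyCompleteLattice E] [AddCommGroup E] [Module ℝ E] [IsOrderedAddMonoid E]
[IsOrderedModule ℝ E]`: an ordered real vector space that is a lattice in which every nonempty
set that is bounded above (below) has a supremum (infimum). -/

/-- Lateral completeness: every nonempty set of pairwise disjoint positive elements has a
supremum.  (The empty set is left out, as it has a supremum only in the zero space.) -/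
class IsLaterallyComplete (E : Type*) [Lattice E] [AddCommGroup E] : Prop where
  exists_isLUB : ∀ s : Set E, s.Nonempty → (∀ x ∈ s, 0 ≤ x) →
    s.Pairwise (fun x y => x ⊓ y = 0) → ∃ u, IsLUB s u

/-- A universally complete vector lattice is one that is Dedekind complete (the instance
`ConditionallyCompleteLattice`) and laterally complete. -/
class IsUniversallyComplete (E : Type*) [ConditionallyCompleteLattice E] [AddCommGroup E] : Prop
    extends IsLaterallyComplete E

/-- A Dedekind complete vector lattice is Archimedean, so that this need not be assumed. -/
theorem vectorLattice_archimedean {E : Type*} [ConditionallyCompleteLattice E] [AddCommGroup E]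
    [IsOrderedAddMonoid E] (x y : E) (h : ∀ n : ℕ, n • x ≤ y) : x ≤ 0 := by
  have hb : BddAbove (Set.range fun n : ℕ => n • x) := ⟨y, by rintro _ ⟨n, rfl⟩; exact h n⟩
  have h1 : (⨆ n : ℕ, n • x) ≤ (⨆ n : ℕ, n • x) - x := by
    refine ciSup_le fun n => ?_
    have := le_ciSup hb (n + 1)
    rw [le_sub_iff_add_le, ← succ_nsmul]
    exact this
  simpa using h1

/-- The laws of a real `Φ`-algebra: the multiplication of a (unital, associative) real algebra
that is also a vector lattice makes it an `f`-algebra. -/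
class IsPhiAlgebra (A : Type*) [Lattice A] [Ring A] [Algebra ℝ A] : Prop where
  mul_nonneg : ∀ a b : A, 0 ≤ a → 0 ≤ b → 0 ≤ a * b
  mul_left_inf : ∀ a b c : A, a ⊓ b = 0 → 0 ≤ c → (c * a) ⊓ b = 0
  mul_right_inf : ∀ a b c : A, a ⊓ b = 0 → 0 ≤ c → (a * c) ⊓ b = 0

/-- A weak order unit: a positive element which is disjoint only from `0`. -/
def IsWeakOrderUnit {E : Type*} [Lattice E] [AddCommGroup E] (u : E) : Prop :=
  0 ≤ u ∧ ∀ x : E, u ⊓ |x| = 0 → x = 0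

/-- The relation `x ≪ y`: the positive part of `y - x` is a weak order unit. -/
def StrictlyBelow {E : Type*} [Lattice E] [AddCommGroup E] (x y : E) : Prop :=
  IsWeakOrderUnit (y - x)⁺

/-! ### The complexification -/

/-- The complexification `E ⊕ iE`; the pair `⟨f, g⟩` stands for `f + ig`. -/
@[ext]
structure Complexification (E : Type*) where
  re : E
  im : E

namespace Complexification

section Ring

variable {E : Type*} [Ring E]

instance : Zero (Complexification E) := ⟨⟨0, 0⟩⟩
instance : One (Complexification E) := ⟨⟨1, 0⟩⟩
instance : Add (Complexification E) := ⟨fun a b => ⟨a.re + b.re, a.im + b.im⟩⟩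
instance : Neg (Complexification E) := ⟨fun a => ⟨-a.re, -a.im⟩⟩

/-- The canonical extension `(f + ig)(h + ik) = (fh - gk) + i(fk + gh)`. -/
instance : Mul (Complexification E) :=
  ⟨fun a b => ⟨a.re * b.re - a.im * b.im, a.re * b.im + a.im * b.re⟩⟩

@[simp] theorem zero_re : (0 : Complexification E).re = 0 := rfl
@[simp] theorem zero_im : (0 : Complexification E).im = 0 := rfl
@[simp] theorem one_re : (1 : Complexification E).re = 1 := rfl
@[simp] theorem one_im : (1 : Complexification E).im = 0 := rfl
@[simp] theorem add_re (a b : Complexification E) : (a + b).re = a.re + b.re := rfl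
@[simp] theorem add_im (a b : Complexification E) : (a + b).im = a.im + b.im := rfl
@[simp] theorem neg_re (a : Complexification E) : (-a).re = -a.re := rfl
@[simp] theorem neg_im (a : Complexification E) : (-a).im = -a.im := rfl
@[simp] theorem mul_re (a b : Complexification E) :
    (a * b).re = a.re * b.re - a.im * b.im := rfl
@[simp] theorem mul_im (a b : Complexification E) :
    (a * b).im = a.re * b.im + a.im * b.re := rfl

instance : Ring (Complexification E) where
  add_assoc a b c := by ext <;> simp [add_assoc]
  zero_add a := by ext <;> simp
  add_zero a := by ext <;> simp
  add_comm a b := by ext <;> simp [add_comm]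
  neg_add_cancel a := by ext <;> simp
  nsmul := nsmulRec
  zsmul := zsmulRec
  mul_assoc a b c := by ext <;> simp <;> noncomm_ring
  one_mul a := by ext <;> simp
  mul_one a := by ext <;> simp
  left_distrib a b c := by ext <;> simp <;> noncomm_ring
  right_distrib a b c := by ext <;> simp <;> noncomm_ring
  zero_mul a := by ext <;> simp
  mul_zero a := by ext <;> simp

/-- The embedding of the real part `E` into `E ⊕ iE`. -/
def ofReal (f : E) : Complexification E := ⟨f, 0⟩

end Ring

/-- The modulus `|f + ig| = sup {(cos θ) f + (sin θ) g : θ ∈ [0, 2π]}`. -/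
noncomputable def modulus {E : Type*} [ConditionallyCompleteLattice E] [AddCommGroup E]
    [Module ℝ E] (a : Complexification E) : E :=
  sSup ((fun θ : ℝ => Real.cos θ • a.re + Real.sin θ • a.im) '' Set.Icc 0 (2 * Real.pi))

/-- The supremum that defines the modulus exists. -/
theorem isLUB_modulus {E : Type*} [ConditionallyCompleteLattice E] [AddCommGroup E]
    [Module ℝ E] [IsOrderedAddMonoid E] [IsOrderedModule ℝ E] (a : Complexification E) :
    IsLUB ((fun θ : ℝ => Real.cos θ • a.re + Real.sin θ • a.im) '' Set.Icc 0 (2 * Real.pi))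
      (modulus a) := by
  have key : ∀ (c : ℝ) (f : E), |c| ≤ 1 → c • f ≤ |f| := by
    intro c f hc
    obtain ⟨h1, h2⟩ := abs_le.1 hc
    rcases le_total 0 c with h | h
    · calc c • f ≤ c • |f| := smul_le_smul_of_nonneg_left (le_abs_self f) h
        _ ≤ (1 : ℝ) • |f| := smul_le_smul_of_nonneg_right h2 (abs_nonneg f)
        _ = |f| := one_smul _ _
    · calc c • f = (-c) • (-f) := by simp
        _ ≤ (-c) • |f| := smul_le_smul_of_nonneg_left (neg_le_abs f) (by linarith)
        _ ≤ (1 : ℝ) • |f| := smul_le_smul_of_nonneg_right (by linarith) (abs_nonneg f)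
        _ = |f| := one_smul _ _
  refine isLUB_csSup ⟨_, 0, ⟨le_rfl, by positivity⟩, rfl⟩ ⟨|a.re| + |a.im|, ?_⟩
  rintro _ ⟨θ, -, rfl⟩
  exact add_le_add (key _ _ (Real.abs_cos_le_one θ)) (key _ _ (Real.abs_sin_le_one θ))

section Convergence

variable {E : Type*} [ConditionallyCompleteLattice E] [Ring E] [Module ℝ E]

/-- The sequence `x` converges in order to `l`: there is a sequence `p n ↓ 0` in the real part
with `|x n - l| ≤ p n` for all `n`. -/
def OrderConvergesTo (x : ℕ → Complexification E) (l : Complexification E) : Prop :=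
  ∃ p : ℕ → E, Antitone p ∧ IsGLB (Set.range p) 0 ∧ ∀ n, modulus (x n - l) ≤ p n

/-- `s` is the sum of the order convergent series `∑ a n`: the partial sums
`a 0 + ⋯ + a m`, `m = 0, 1, 2, …`, converge in order to `s`. -/
def HasOrderSum (a : ℕ → Complexification E) (s : Complexification E) : Prop :=
  OrderConvergesTo (fun m => ∑ n ∈ Finset.range (m + 1), a n) s

/-- The series `∑ a n` converges absolutely in order: the series `∑ |a n|` converges in order. -/
def AbsConvergesInOrder (a : ℕ → Complexification E) : Prop :=
  ∃ s, HasOrderSum (fun n => ofReal (modulus (a n))) s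

end Convergence

end Complexification

/-!
The modulus of the complexification is multiplicative, so `|a ^ n| = r ^ n` with `r = |a|`. If
`d = e - r` is a weak order unit and `0 ≤ z ≤ r ^ n` for all `n`, then
`n z d ≤ (e + r + ⋯ + r ^ (n - 1)) d ≤ e` for all `n`, which forces `z d = 0` and `z = 0`; hence
`r ^ n ↓ 0`. Conversely, on the elements disjoint from `(e - r)⁺` multiplication by `r` does not
decrease absolute values, so `r ^ n` can be dominated by a sequence decreasing to `0` only if
`r ≪ e`. In a universally complete `Φ`-algebra weak order units are invertible. Since
`e - |a| ≤ |e - a|`, the element `e - a` is invertible when `|a| ≪ e`, and the `m`-th partial sum of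
the geometric series differs from `(e - a)⁻¹` by `-a ^ (m + 1) (e - a)⁻¹`, which tends to `0` in
order.
-/

/-- A lattice-ordered group is Archimedean if `x ≤ 0` whenever the multiples of `x` have a common
upper bound. (Mathlib's `Archimedean` asks every positive element to be cofinal, which suits linear
orders only.) -/
class IsArchimedeanLattice (E : Type*) [Lattice E] [AddCommGroup E] : Prop where
  nonpos_of_forall_nsmul_le : ∀ x y : E, (∀ n : ℕ, n • x ≤ y) → x ≤ 0

open IsArchimedeanLattice (nonpos_of_forall_nsmul_le)

instance (E : Type*) [ConditionallyCompleteLattice E] [AddCommGroup E] [IsOrderedAddMonoid E] :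
    IsArchimedeanLattice E :=
  ⟨vectorLattice_archimedean⟩

section LatticeGroup

variable {E : Type*} [Lattice E] [AddCommGroup E]

theorem abs_le_posPart_sup_negPart (x : E) : |x| ≤ x⁺ ⊔ x⁻ :=
  sup_le_sup (le_posPart x) (neg_le_negPart x)

variable [IsOrderedAddMonoid E]

theorem eq_zero_of_abs_nonpos {x : E} (h : |x| ≤ 0) : x = 0 :=
  le_antisymm ((le_abs_self x).trans h) (neg_nonpos.1 ((neg_le_abs x).trans h))

theorem inf_add_le_inf_add {x y z : E} (hz : 0 ≤ z) : x ⊓ (y + z) ≤ x ⊓ y + z := by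
  rw [inf_add]
  exact inf_le_inf_right _ (le_add_of_nonneg_right hz)

/-- A discrete intermediate value theorem. -/
theorem inf_posPart_inf_negPart_le_of_abs_sub_le {y : ℕ → E} {t d : E}
    (ht : ∀ j, t ≤ |y j|) (hd : ∀ j, |y (j + 1) - y j| ≤ d) (n : ℕ) :
    t ⊓ (y 0)⁺ ⊓ (y n)⁻ ≤ d := by
  have hd0 : 0 ≤ d := (abs_nonneg _).trans (hd 0)
  let : DistribLattice E := AddCommGroup.toDistribLattice E
  induction n with
  | zero =>
    calc t ⊓ (y 0)⁺ ⊓ (y 0)⁻ ≤ (y 0)⁺ ⊓ (y 0)⁻ := inf_le_inf_right _ inf_le_right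
      _ ≤ d := (posPart_inf_negPart_eq_zero _).trans_le hd0
  | succ k ih =>
    have hsup : t ⊓ (y 0)⁺ ⊓ (y (k + 1))⁻ ≤ (y k)⁺ ⊔ (y k)⁻ :=
      (inf_le_left.trans inf_le_left).trans ((ht k).trans (abs_le_posPart_sup_negPart _))
    have hpos : (y k)⁺ ≤ (y (k + 1))⁺ + d := by
      refine sup_le ?_ (add_nonneg (posPart_nonneg _) hd0)
      have hstep : y k - y (k + 1) ≤ d := neg_sub (y (k + 1)) (y k) ▸ (neg_le_abs _).trans (hd k)
      exact (sub_le_iff_le_add'.1 hstep).trans (add_le_add_left (le_posPart _) d)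
    rw [← inf_eq_left.2 hsup, inf_sup_left]
    refine sup_le ?_ ((inf_le_inf_right _ inf_le_left).trans ih)
    calc t ⊓ (y 0)⁺ ⊓ (y (k + 1))⁻ ⊓ (y k)⁺
        ≤ (y (k + 1))⁻ ⊓ ((y (k + 1))⁺ + d) := inf_le_inf inf_le_right hpos
      _ ≤ (y (k + 1))⁻ ⊓ (y (k + 1))⁺ + d := inf_add_le_inf_add hd0
      _ = d := by rw [inf_comm, posPart_inf_negPart_eq_zero, zero_add]

theorem le_of_abs_sub_le_of_nonneg_of_nonpos {y : ℕ → E} {t d : E} {n : ℕ}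
    (ht : ∀ j, t ≤ |y j|) (hd : ∀ j, |y (j + 1) - y j| ≤ d) (h0 : 0 ≤ y 0) (hn : y n ≤ 0) :
    t ≤ d := by
  have h := inf_posPart_inf_negPart_le_of_abs_sub_le ht hd n
  rwa [posPart_eq_self.2 h0, negPart_eq_neg.2 hn, ← abs_of_nonneg h0, inf_eq_left.2 (ht 0),
    ← abs_of_nonpos hn, inf_eq_left.2 (ht n)] at h

theorem le_of_abs_sub_le_of_eq_neg {y : ℕ → E} {t d : E} {n : ℕ}
    (ht : ∀ j, t ≤ |y j|) (hd : ∀ j, |y (j + 1) - y j| ≤ d) (hn : y n = -y 0) : t ≤ d := by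
  let : DistribLattice E := AddCommGroup.toDistribLattice E
  have hpos : t ⊓ (y 0)⁺ ≤ d := by
    have h := inf_posPart_inf_negPart_le_of_abs_sub_le ht hd n
    rwa [hn, negPart_neg, inf_assoc, inf_idem] at h
  have hneg : t ⊓ (y 0)⁻ ≤ d := by
    have h := inf_posPart_inf_negPart_le_of_abs_sub_le (y := fun j => -y j) (t := t) (d := d)
      (fun j => (abs_neg (y j)).symm ▸ ht j)
      (fun j => by rw [neg_sub_neg, abs_sub_comm]; exact hd j) n
    rwa [hn, posPart_neg, neg_neg, inf_assoc, inf_idem] at h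
  calc t ≤ t ⊓ ((y 0)⁺ ⊔ (y 0)⁻) := le_inf le_rfl ((ht 0).trans (abs_le_posPart_sup_negPart _))
    _ = t ⊓ (y 0)⁺ ⊔ t ⊓ (y 0)⁻ := inf_sup_left _ _ _
    _ ≤ d := sup_le hpos hneg

end LatticeGroup

section VectorLattice

variable {E : Type*} [Lattice E] [AddCommGroup E] [Module ℝ E] [IsOrderedAddMonoid E]
  [IsOrderedModule ℝ E]

theorem abs_smul_le_smul_abs {c r : ℝ} (h : |c| ≤ r) (x : E) : |c • x| ≤ r • |x| := by
  suffices H : ∀ y : E, c • y ≤ r • |y| from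
    abs_le'.2 ⟨H x, by simpa only [smul_neg, abs_neg] using H (-x)⟩
  intro y
  refine le_trans ?_ (smul_le_smul_of_nonneg_right h (abs_nonneg y))
  rcases abs_cases c with ⟨hc, h0⟩ | ⟨hc, h0⟩ <;> rw [hc]
  · exact smul_le_smul_of_nonneg_left (le_abs_self y) h0
  · rw [← neg_smul_neg]
    exact smul_le_smul_of_nonneg_left (neg_le_abs y) (neg_nonneg.2 h0.le)

/-- Rotating `f + ig` through half a turn carries its real part to the negative of it. -/
theorem nonpos_of_forall_le_abs_cos_smul_add_sin_smul [IsArchimedeanLattice E] {f g t : E}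
    (h : ∀ θ : ℝ, t ≤ |Real.cos θ • f + Real.sin θ • g|) : t ≤ 0 := by
  refine nonpos_of_forall_nsmul_le t (Real.pi • (|f| + |g|)) fun n => ?_
  rcases n.eq_zero_or_pos with rfl | hn
  · rw [zero_smul]
    exact smul_nonneg Real.pi_pos.le (add_nonneg (abs_nonneg f) (abs_nonneg g))
  have hn' : (0 : ℝ) < n := Nat.cast_pos.2 hn
  have hstep : ∀ j : ℕ, |((j + 1 : ℕ) * (Real.pi / n) - j * (Real.pi / n) : ℝ)| = Real.pi / n := by
    intro j
    rw [Nat.cast_succ, add_one_mul, add_sub_cancel_left, abs_of_nonneg (by positivity)]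
  have ht : t ≤ (Real.pi / n) • (|f| + |g|) := by
    refine le_of_abs_sub_le_of_eq_neg (n := n) (fun j : ℕ => h (j * (Real.pi / n)))
      (fun j => ?_) ?_
    · rw [add_sub_add_comm, ← sub_smul, ← sub_smul, smul_add]
      exact (abs_add_le _ _).trans <| add_le_add
        (abs_smul_le_smul_abs ((Real.abs_cos_sub_cos_le _ _).trans_eq (hstep j)) f)
        (abs_smul_le_smul_abs ((Real.abs_sin_sub_sin_le _ _).trans_eq (hstep j)) g)
    · simp [mul_div_cancel₀ _ hn'.ne']
  calc n • t ≤ n • (Real.pi / n) • (|f| + |g|) := nsmul_le_nsmul_right ht n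
    _ = Real.pi • (|f| + |g|) := by
      rw [← Nat.cast_smul_eq_nsmul ℝ, smul_smul, mul_div_cancel₀ _ hn'.ne']

end VectorLattice

namespace PhiAlgebra

section Lattice

variable {E : Type*} [Lattice E] [Ring E] [Algebra ℝ E] [IsPhiAlgebra E]

theorem mul_eq_zero_of_inf_eq_zero {x y : E} (h : x ⊓ y = 0) : x * y = 0 := by
  have hx : 0 ≤ x := h ▸ inf_le_left
  have hy : 0 ≤ y := h ▸ inf_le_right
  have h' := IsPhiAlgebra.mul_left_inf y (x * y) x
    (inf_comm _ y ▸ IsPhiAlgebra.mul_right_inf x y y h hy) hx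
  rwa [inf_idem] at h'

variable [IsOrderedAddMonoid E]

variable (E) in
theorem zero_le_one : (0 : E) ≤ 1 := by
  have hdisj : ((1 : E)⁻ * 1⁺) ⊓ 1⁻ = 0 :=
    IsPhiAlgebra.mul_left_inf _ _ _ (posPart_inf_negPart_eq_zero 1) (negPart_nonneg 1)
  have hle : (1 : E)⁻ ≤ 1⁻ * 1⁺ := by
    have hpos : (1 : E)⁺ = 1⁻ + 1 := sub_eq_iff_eq_add'.1 (posPart_sub_negPart 1)
    rw [hpos, mul_add, mul_one]
    exact le_add_of_nonneg_left
      (IsPhiAlgebra.mul_nonneg _ _ (negPart_nonneg 1) (negPart_nonneg 1))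
  exact negPart_eq_zero.1 ((inf_eq_right.2 hle).symm.trans hdisj)

instance isOrderedRing : IsOrderedRing E :=
  have : ZeroLEOneClass E := ⟨zero_le_one E⟩
  .of_mul_nonneg IsPhiAlgebra.mul_nonneg

theorem mul_inf {c : E} (hc : 0 ≤ c) (x y : E) : c * (x ⊓ y) = c * x ⊓ c * y := by
  have h : (x - x ⊓ y) ⊓ (y - x ⊓ y) = 0 := by rw [← inf_sub, sub_self]
  have h' := IsPhiAlgebra.mul_left_inf _ _ c (inf_comm _ (y - x ⊓ y) ▸
    IsPhiAlgebra.mul_left_inf _ _ c h hc) hc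
  rw [mul_sub, mul_sub, ← inf_sub, sub_eq_zero, inf_comm] at h'
  exact h'.symm

theorem inf_mul {c : E} (hc : 0 ≤ c) (x y : E) : (x ⊓ y) * c = x * c ⊓ y * c := by
  have h : (x - x ⊓ y) ⊓ (y - x ⊓ y) = 0 := by rw [← inf_sub, sub_self]
  have h' := IsPhiAlgebra.mul_right_inf _ _ c (inf_comm _ (y - x ⊓ y) ▸
    IsPhiAlgebra.mul_right_inf _ _ c h hc) hc
  rw [sub_mul, sub_mul, ← inf_sub, sub_eq_zero, inf_comm] at h'
  exact h'.symm

theorem abs_mul_of_nonneg_left {c : E} (hc : 0 ≤ c) (x : E) : |c * x| = c * |x| := by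
  rw [← neg_inj, ← mul_neg, abs, abs, neg_sup, neg_sup, mul_inf hc, mul_neg, mul_neg, mul_neg]

theorem abs_mul_of_nonneg_right {c : E} (hc : 0 ≤ c) (x : E) : |x * c| = |x| * c := by
  rw [← neg_inj, ← neg_mul, abs, abs, neg_sup, neg_sup, inf_mul hc, neg_mul, neg_mul, neg_mul]

theorem posPart_mul_negPart (x : E) : x⁺ * x⁻ = 0 :=
  mul_eq_zero_of_inf_eq_zero (posPart_inf_negPart_eq_zero x)

theorem negPart_mul_posPart (x : E) : x⁻ * x⁺ = 0 :=
  mul_eq_zero_of_inf_eq_zero (inf_comm x⁺ x⁻ ▸ posPart_inf_negPart_eq_zero x)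

theorem posPart_mul_self (x : E) : x⁺ * x = x⁺ * x⁺ :=
  calc x⁺ * x = x⁺ * (x⁺ - x⁻) := by rw [posPart_sub_negPart]
    _ = x⁺ * x⁺ := by rw [mul_sub, posPart_mul_negPart, sub_zero]

theorem abs_mul_abs_self (x : E) : |x| * |x| = x * x := by
  conv_rhs => rw [← posPart_sub_negPart x]
  rw [← posPart_add_negPart, add_mul, mul_add, mul_add, sub_mul, mul_sub, mul_sub,
    posPart_mul_negPart, negPart_mul_posPart]
  abel

theorem mul_self_nonneg (x : E) : 0 ≤ x * x :=
  abs_mul_abs_self x ▸ mul_nonneg (abs_nonneg x) (abs_nonneg x)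

theorem posPart_mul_posPart_le (x : E) : x⁺ * x⁺ ≤ x * x := by
  have hle : x⁺ ≤ |x| := sup_le (le_abs_self x) (abs_nonneg x)
  exact abs_mul_abs_self x ▸ mul_le_mul hle hle (posPart_nonneg x) (abs_nonneg x)

theorem posPart_sub_mul_le (b x : E) : (b - x)⁺ * x ≤ (b - x)⁺ * b := by
  rw [← sub_nonneg, ← mul_sub, posPart_mul_self]
  exact mul_self_nonneg _

theorem nsmul_posPart_sub_natCast_le {c : E} (hc : 0 ≤ c) (n : ℕ) : n • (c - n)⁺ ≤ c * c :=
  calc n • (c - n)⁺ = (c - n)⁺ * n := by rw [nsmul_eq_mul, Nat.cast_comm]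
    _ ≤ (c - n)⁺ * c := posPart_sub_mul_le c n
    _ ≤ c * c := mul_le_mul_of_nonneg_right (sup_le (sub_le_self c (Nat.cast_nonneg n)) hc) hc

theorem abs_nsmul (n : ℕ) (x : E) : |n • x| = n • |x| := by
  rw [nsmul_eq_mul, abs_mul_of_nonneg_left (Nat.cast_nonneg n), ← nsmul_eq_mul]

theorem abs_commutator_le_nsmul_abs {c : E} {k : ℕ} (hc : 0 ≤ c) (hck : c ≤ k) (x : E) :
    |c * x - x * c| ≤ (2 * k) • |x| :=
  calc |c * x - x * c| ≤ |c * x| + |x * c| := by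
        simpa only [sub_eq_add_neg, abs_neg] using abs_add_le (c * x) (-(x * c))
    _ = c * |x| + |x| * c := by rw [abs_mul_of_nonneg_left hc, abs_mul_of_nonneg_right hc]
    _ ≤ k * |x| + |x| * k :=
        add_le_add (mul_le_mul_of_nonneg_right hck (abs_nonneg x))
          (mul_le_mul_of_nonneg_left hck (abs_nonneg x))
    _ = (2 * k) • |x| := by
        rw [nsmul_eq_mul, ← Nat.cast_comm, Nat.cast_mul, Nat.cast_two, two_mul, add_mul]

end Lattice

section Archimedean

variable {E : Type*} [Lattice E] [Ring E] [Algebra ℝ E] [IsOrderedAddMonoid E] [IsPhiAlgebra E]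
  [IsArchimedeanLattice E]

/-- Since `c` commutes with `j • 1`, the commutator of `c` with `n • x` is controlled by
`n • x - j • 1` for every `j`, and some `j` makes this small by the intermediate value theorem. -/
theorem commute_of_nonneg_of_le_natCast {c x : E} {k : ℕ} (hc : 0 ≤ c) (hck : c ≤ k)
    (hx : 0 ≤ x) (hxk : x ≤ k) : Commute c x := by
  refine sub_eq_zero.1 (eq_zero_of_abs_nonpos
    (nonpos_of_forall_nsmul_le _ ((2 * k) • 1) fun n => ?_))
  refine le_of_abs_sub_le_of_nonneg_of_nonpos (n := n * k)
    (y := fun j => (2 * k) • (n • x - j • (1 : E))) (fun j => ?_) (fun j => ?_) ?_ ?_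
  · have hcomm : n • (c * x - x * c) = c * (n • x - j • (1 : E)) - (n • x - j • (1 : E)) * c := by
      simp only [nsmul_eq_mul, mul_sub, sub_mul, ← mul_assoc, mul_one]
      rw [Nat.cast_comm j, Nat.cast_comm n c]
      abel
    rw [← abs_nsmul, hcomm, abs_nsmul]
    exact abs_commutator_le_nsmul_abs hc hck _
  · have hstep : n • x - (j + 1) • (1 : E) - (n • x - j • (1 : E)) = -1 := by
      rw [succ_nsmul]
      abel
    rw [← nsmul_sub, hstep, smul_neg, abs_neg, abs_of_nonneg (nsmul_nonneg (zero_le_one E) _)]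
  · rw [zero_smul, sub_zero]
    exact nsmul_nonneg (nsmul_nonneg hx _) _
  · refine nsmul_nonpos (sub_nonpos.2 ?_) _
    rw [mul_nsmul', nsmul_one k]
    exact nsmul_le_nsmul_right hxk n

theorem commute_of_forall_commute_inf_natCast {c x : E} (hc : 0 ≤ c) (hx : 0 ≤ x)
    (h : ∀ n : ℕ, Commute (c ⊓ n) x) : Commute c x := by
  refine sub_eq_zero.1 (eq_zero_of_abs_nonpos
    (nonpos_of_forall_nsmul_le _ (c * c * x + x * (c * c)) fun n => ?_))
  have hu := nsmul_posPart_sub_natCast_le hc n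
  set u := (c - n)⁺ with hu_def
  have hu0 : 0 ≤ u := posPart_nonneg _
  have hcomm : c * x - x * c = u * x + -(x * u) := by
    have := (h n).eq
    rw [inf_eq_sub_posPart_sub, ← hu_def, sub_mul, mul_sub, sub_eq_sub_iff_add_eq_add] at this
    rw [← sub_eq_add_neg, sub_eq_sub_iff_add_eq_add, this, add_comm]
  calc n • |c * x - x * c| ≤ n • (u * x + x * u) := by
        refine nsmul_le_nsmul_right (hcomm ▸ (abs_add_le _ _).trans_eq ?_) n
        rw [abs_neg, abs_of_nonneg (mul_nonneg hu0 hx), abs_of_nonneg (mul_nonneg hx hu0)]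
    _ = n • u * x + x * n • u := by rw [nsmul_add, smul_mul_assoc, mul_smul_comm]
    _ ≤ c * c * x + x * (c * c) :=
        add_le_add (mul_le_mul_of_nonneg_right hu hx) (mul_le_mul_of_nonneg_left hu hx)

theorem commute_of_nonneg {c x : E} (hc : 0 ≤ c) (hx : 0 ≤ x) : Commute c x := by
  have hinf {z : E} (hz : 0 ≤ z) (n : ℕ) : 0 ≤ z ⊓ n := le_inf hz (Nat.cast_nonneg n)
  refine commute_of_forall_commute_inf_natCast hc hx fun n => Commute.symm ?_
  refine commute_of_forall_commute_inf_natCast hx (hinf hc n) fun m => ?_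
  refine commute_of_nonneg_of_le_natCast (k := m + n) (hinf hx m) ?_ (hinf hc n) ?_
  · exact inf_le_right.trans (Nat.mono_cast (m.le_add_right n))
  · exact inf_le_right.trans (Nat.mono_cast (n.le_add_left m))

theorem commute (x y : E) : Commute x y := by
  have h {c z : E} (hc : 0 ≤ c) : Commute c z := by
    rw [← posPart_sub_negPart z]
    exact (commute_of_nonneg hc (posPart_nonneg z)).sub_right
      (commute_of_nonneg hc (negPart_nonneg z))
  rw [← posPart_sub_negPart x]
  exact (h (posPart_nonneg x)).sub_left (h (negPart_nonneg x))

theorem eq_zero_of_mul_self_eq_zero {y : E} (h : y * y = 0) : y = 0 := by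
  have hsq : |y| * |y| = 0 := (abs_mul_abs_self y).trans h
  have htwo : |y| + |y| ≤ 0 := by
    refine nonpos_of_forall_nsmul_le _ 1 fun n => sub_nonneg.1 ?_
    have hexp : (1 - n • |y|) * (1 - n • |y|) = 1 - n • (|y| + |y|) := by
      simp only [sub_mul, mul_sub, mul_one, one_mul, smul_mul_assoc, mul_smul_comm, hsq, smul_zero,
        nsmul_add, sub_zero, sub_sub]
    exact hexp ▸ mul_self_nonneg (1 - n • |y|)
  exact eq_zero_of_abs_nonpos ((le_add_of_nonneg_right (abs_nonneg y)).trans htwo)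

theorem inf_eq_zero_iff_mul_eq_zero {x y : E} (hx : 0 ≤ x) (hy : 0 ≤ y) :
    x ⊓ y = 0 ↔ x * y = 0 := by
  refine ⟨mul_eq_zero_of_inf_eq_zero, fun h => eq_zero_of_mul_self_eq_zero ?_⟩
  have hinf : 0 ≤ x ⊓ y := le_inf hx hy
  exact le_antisymm (h ▸ mul_le_mul inf_le_left inf_le_right hinf hx) (mul_nonneg hinf hinf)

end Archimedean

section CommRing

variable {E : Type*} [Lattice E] [CommRing E] [Algebra ℝ E] [IsOrderedAddMonoid E]
  [IsPhiAlgebra E]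

theorem nsmul_mul_le_sq_nsmul_add {c w : E} (hc : 0 ≤ c) (hw : 0 ≤ w) (n : ℕ) :
    n • (c * w) ≤ (n ^ 2) • w + c * c * w := by
  have hsq : 0 ≤ (c - n) * (c - n) * w + n • (c * w) :=
    add_nonneg (mul_nonneg (mul_self_nonneg _) hw) (nsmul_nonneg (mul_nonneg hc hw) n)
  refine sub_nonneg.1 (hsq.trans_eq ?_)
  simp only [nsmul_eq_mul, Nat.cast_pow]
  ring

theorem eq_of_mul_self_eq [IsArchimedeanLattice E] {x y : E} (hx : 0 ≤ x) (hy : 0 ≤ y)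
    (h : x * x = y * y) : x = y := by
  have hprod : |x - y| * (x + y) = 0 := by
    rw [← abs_mul_of_nonneg_right (add_nonneg hx hy), mul_comm, ← mul_self_sub_mul_self, h,
      sub_self, abs_zero]
  have hle : |x - y| ≤ x + y := by
    simpa only [sub_eq_add_neg, abs_neg, abs_of_nonneg hx, abs_of_nonneg hy]
      using abs_add_le x (-y)
  have hsq : (x - y) * (x - y) ≤ 0 := by
    rw [← abs_mul_abs_self, ← hprod]
    exact mul_le_mul_of_nonneg_left hle (abs_nonneg _)
  exact sub_eq_zero.1 (eq_zero_of_mul_self_eq_zero (le_antisymm hsq (mul_self_nonneg _)))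

variable [IsOrderedModule ℝ E]

theorem mul_le_of_mul_self_le {x y s : E} (hx : x * x ≤ s) (hy : y * y ≤ s) : x * y ≤ s := by
  refine le_of_smul_le_smul_of_pos_left (a := (2 : ℝ)) ?_ two_pos
  rw [two_smul, two_smul]
  refine le_trans (sub_nonneg.1 ((mul_self_nonneg (x - y)).trans_eq ?_)) (add_le_add hx hy)
  ring

/-- For `z` below all `c * x` with `x ∈ s`, and `y ∈ s` fixed, the elements `w = x ⊓ y` satisfy
`n z ≤ n c w ≤ n² w + c² w ≤ n² x + c² y`, and `c² y` depends neither on `n` nor on `x`. -/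
theorem isGLB_mul_left [IsArchimedeanLattice E] {s : Set E} {c : E} (hc : 0 ≤ c)
    (hs : s.Nonempty) (h : IsGLB s 0) : IsGLB ((c * ·) '' s) 0 := by
  refine ⟨Set.forall_mem_image.2 fun x hx => mul_nonneg hc (h.1 hx), fun z hz => ?_⟩
  obtain ⟨y, hy⟩ := hs
  have hz' : ∀ x ∈ s, z ≤ c * x := Set.forall_mem_image.1 hz
  refine nonpos_of_forall_nsmul_le z (c * c * y) fun n => ?_
  rcases n.eq_zero_or_pos with rfl | hn
  · rw [zero_smul]
    exact mul_nonneg (mul_self_nonneg c) (h.1 hy)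
  have hbound : ∀ x ∈ s, n • z - c * c * y ≤ ((n : ℝ) ^ 2) • x := fun x hx => by
    have hw : 0 ≤ x ⊓ y := le_inf (h.1 hx) (h.1 hy)
    rw [sub_le_iff_le_add, ← Nat.cast_pow, Nat.cast_smul_eq_nsmul]
    calc n • z ≤ n • (c * (x ⊓ y)) :=
          nsmul_le_nsmul_right (mul_inf hc x y ▸ le_inf (hz' x hx) (hz' y hy)) n
      _ ≤ (n ^ 2) • (x ⊓ y) + c * c * (x ⊓ y) := nsmul_mul_le_sq_nsmul_add hc hw n
      _ ≤ (n ^ 2) • x + c * c * y := add_le_add (nsmul_le_nsmul_right inf_le_left _)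
          (mul_le_mul_of_nonneg_left inf_le_right (mul_self_nonneg c))
  have hn2 : (0 : ℝ) < (n : ℝ) ^ 2 := by positivity
  have hscaled := h.2 fun x hx => (inv_smul_le_iff_of_pos hn2).2 (hbound x hx)
  rwa [inv_smul_le_iff_of_pos hn2, smul_zero, sub_nonpos] at hscaled

theorem isLUB_mul_left [IsArchimedeanLattice E] {s : Set E} {c m : E} (hc : 0 ≤ c)
    (hs : s.Nonempty) (h : IsLUB s m) : IsLUB ((c * ·) '' s) (c * m) := by
  have hsub : IsGLB ((m - ·) '' s) 0 := by
    refine ⟨Set.forall_mem_image.2 fun x hx => sub_nonneg.2 (h.1 hx), fun z hz => ?_⟩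
    have hle : m ≤ m - z := h.2 fun x hx => le_sub_comm.1 (hz (Set.mem_image_of_mem _ hx))
    exact (le_sub_self_iff m).1 hle
  refine ⟨Set.forall_mem_image.2 fun x hx => mul_le_mul_of_nonneg_left (h.1 hx) hc,
    fun z hz => sub_nonpos.1 ((isGLB_mul_left hc (hs.image _) hsub).2 ?_)⟩
  simp only [Set.image_image, mul_sub]
  exact Set.forall_mem_image.2 fun x hx => sub_le_sub_left (hz (Set.mem_image_of_mem _ hx)) _

end CommRing

end PhiAlgebra

namespace Complexification

section Modulus

variable {E : Type*} [AddCommGroup E] [Module ℝ E]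

/-- The real part `cos θ f + sin θ g` of `exp (-iθ) (f + ig)`. The modulus is the supremum of these
elements. -/
noncomputable def rotatedRe (a : Complexification E) (θ : ℝ) : E :=
  Real.cos θ • a.re + Real.sin θ • a.im

theorem rotatedRe_add_pi (a : Complexification E) (θ : ℝ) :
    rotatedRe a (θ + Real.pi) = -rotatedRe a θ := by
  simp only [rotatedRe, Real.cos_add_pi, Real.sin_add_pi, neg_smul, neg_add]

variable [ConditionallyCompleteLattice E] [IsOrderedAddMonoid E] [IsOrderedModule ℝ E]

theorem isLUB_range_rotatedRe (a : Complexification E) :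
    IsLUB (Set.range (rotatedRe a)) (modulus a) := by
  have hperiodic : Function.Periodic (rotatedRe a) (2 * Real.pi) := fun θ => by
    simp only [rotatedRe, Real.cos_add_two_pi, Real.sin_add_two_pi]
  rw [← hperiodic.image_Icc Real.two_pi_pos 0, zero_add]
  exact isLUB_modulus a

theorem rotatedRe_le_modulus (a : Complexification E) (θ : ℝ) : rotatedRe a θ ≤ modulus a :=
  (isLUB_range_rotatedRe a).1 (Set.mem_range_self θ)

theorem modulus_le {a : Complexification E} {z : E} (h : ∀ θ, rotatedRe a θ ≤ z) :
    modulus a ≤ z :=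
  (isLUB_range_rotatedRe a).2 (Set.forall_mem_range.2 h)

theorem abs_rotatedRe_le_modulus (a : Complexification E) (θ : ℝ) :
    |rotatedRe a θ| ≤ modulus a :=
  abs_le'.2 ⟨rotatedRe_le_modulus a θ, rotatedRe_add_pi a θ ▸ rotatedRe_le_modulus a _⟩

theorem abs_re_le_modulus (a : Complexification E) : |a.re| ≤ modulus a := by
  simpa [rotatedRe] using abs_rotatedRe_le_modulus a 0

theorem abs_im_le_modulus (a : Complexification E) : |a.im| ≤ modulus a := by
  simpa [rotatedRe] using abs_rotatedRe_le_modulus a (Real.pi / 2)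

theorem modulus_nonneg (a : Complexification E) : 0 ≤ modulus a :=
  (abs_nonneg _).trans (abs_re_le_modulus a)

end Modulus

section Ring

variable {E : Type*} [ConditionallyCompleteLattice E] [Ring E] [Module ℝ E]
  [IsOrderedAddMonoid E] [IsOrderedModule ℝ E]

theorem eq_zero_of_modulus_nonpos {a : Complexification E} (h : modulus a ≤ 0) : a = 0 :=
  Complexification.ext (eq_zero_of_abs_nonpos ((abs_re_le_modulus a).trans h))
    (eq_zero_of_abs_nonpos ((abs_im_le_modulus a).trans h))

theorem modulus_ofReal (f : E) : modulus (ofReal f) = |f| := by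
  refine le_antisymm (modulus_le fun θ => ?_) (abs_re_le_modulus (ofReal f))
  calc rotatedRe (ofReal f) θ = Real.cos θ • f := by
        simp only [rotatedRe, ofReal, smul_zero, add_zero]
    _ ≤ |Real.cos θ • f| := le_abs_self _
    _ ≤ (1 : ℝ) • |f| := abs_smul_le_smul_abs (Real.abs_cos_le_one θ) f
    _ = |f| := one_smul ℝ _

theorem modulus_add_le (a b : Complexification E) : modulus (a + b) ≤ modulus a + modulus b := by
  refine modulus_le fun θ => ?_
  calc rotatedRe (a + b) θ = rotatedRe a θ + rotatedRe b θ := by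
        simp only [rotatedRe, add_re, add_im, smul_add, add_add_add_comm]
    _ ≤ modulus a + modulus b := add_le_add (rotatedRe_le_modulus a θ) (rotatedRe_le_modulus b θ)

theorem modulus_neg (a : Complexification E) : modulus (-a) = modulus a := by
  have hle (b : Complexification E) : modulus (-b) ≤ modulus b := modulus_le fun θ => by
    have hrot : rotatedRe (-b) θ = rotatedRe b (θ + Real.pi) := by
      rw [rotatedRe_add_pi]
      simp only [rotatedRe, neg_re, neg_im, smul_neg, neg_add]
    exact hrot ▸ rotatedRe_le_modulus b _
  refine le_antisymm (hle a) ?_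
  simpa only [neg_neg] using hle (-a)

theorem modulus_sub_comm (a b : Complexification E) : modulus (a - b) = modulus (b - a) := by
  rw [← modulus_neg, neg_sub]

theorem modulus_sub_le (a b c : Complexification E) :
    modulus (a - c) ≤ modulus (a - b) + modulus (b - c) :=
  sub_add_sub_cancel a b c ▸ modulus_add_le (a - b) (b - c)

end Ring

section CommRing

variable {E : Type*} [CommRing E] [Algebra ℝ E]

theorem rotatedRe_mul_self_add (a : Complexification E) (θ : ℝ) :
    rotatedRe a θ * rotatedRe a θ +
      rotatedRe a (θ + Real.pi / 2) * rotatedRe a (θ + Real.pi / 2) =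
      a.re * a.re + a.im * a.im := by
  have h : algebraMap ℝ E (Real.sin θ) ^ 2 + algebraMap ℝ E (Real.cos θ) ^ 2 = 1 := by
    rw [← map_pow, ← map_pow, ← map_add, Real.sin_sq_add_cos_sq, map_one]
  simp only [rotatedRe, Real.cos_add_pi_div_two, Real.sin_add_pi_div_two, Algebra.smul_def, map_neg]
  linear_combination (a.re * a.re + a.im * a.im) * h

variable [ConditionallyCompleteLattice E] [IsOrderedAddMonoid E] [IsPhiAlgebra E]

theorem rotatedRe_mul_self_le (a : Complexification E) (θ : ℝ) :
    rotatedRe a θ * rotatedRe a θ ≤ a.re * a.re + a.im * a.im :=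
  rotatedRe_mul_self_add a θ ▸ le_add_of_nonneg_right (PhiAlgebra.mul_self_nonneg _)

variable [IsOrderedModule ℝ E]

theorem modulus_mul_self_le (a : Complexification E) :
    modulus a * modulus a ≤ a.re * a.re + a.im * a.im := by
  have hLUB {c : E} (hc : 0 ≤ c) :=
    PhiAlgebra.isLUB_mul_left hc (Set.range_nonempty _) (isLUB_range_rotatedRe a)
  have hpos (θ : ℝ) : (rotatedRe a θ)⁺ * (rotatedRe a θ)⁺ ≤ a.re * a.re + a.im * a.im :=
    (PhiAlgebra.posPart_mul_posPart_le _).trans (rotatedRe_mul_self_le a θ)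
  refine (hLUB (modulus_nonneg a)).2 (Set.forall_mem_image.2 (Set.forall_mem_range.2 fun θ => ?_))
  calc modulus a * rotatedRe a θ ≤ modulus a * (rotatedRe a θ)⁺ :=
        mul_le_mul_of_nonneg_left (le_posPart _) (modulus_nonneg a)
    _ = (rotatedRe a θ)⁺ * modulus a := mul_comm _ _
    _ ≤ a.re * a.re + a.im * a.im :=
        (hLUB (posPart_nonneg _)).2 (Set.forall_mem_image.2 (Set.forall_mem_range.2 fun φ =>
          PhiAlgebra.mul_le_of_mul_self_le (hpos θ) (rotatedRe_mul_self_le a φ)))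

theorem le_modulus_mul_self (a : Complexification E) :
    a.re * a.re + a.im * a.im ≤ modulus a * modulus a := by
  have hm := modulus_nonneg a
  refine sub_nonpos.1 (nonpos_of_forall_le_abs_cos_smul_add_sin_smul
    (f := a.re * modulus a) (g := a.im * modulus a) fun θ => ?_)
  have habs (φ : ℝ) : rotatedRe a φ * rotatedRe a φ ≤ |rotatedRe a φ| * modulus a := by
    rw [← PhiAlgebra.abs_mul_abs_self]
    exact mul_le_mul_of_nonneg_left (abs_rotatedRe_le_modulus a φ) (abs_nonneg _)
  calc a.re * a.re + a.im * a.im - modulus a * modulus a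
      ≤ |rotatedRe a θ| * modulus a := by
        rw [← rotatedRe_mul_self_add a θ, sub_le_iff_le_add]
        exact add_le_add (habs θ) ((habs _).trans
          (mul_le_mul_of_nonneg_right (abs_rotatedRe_le_modulus a _) hm))
    _ = |Real.cos θ • (a.re * modulus a) + Real.sin θ • (a.im * modulus a)| := by
        rw [← PhiAlgebra.abs_mul_of_nonneg_right hm, rotatedRe, add_mul, smul_mul_assoc,
          smul_mul_assoc]

theorem modulus_mul_self (a : Complexification E) :
    modulus a * modulus a = a.re * a.re + a.im * a.im :=
  le_antisymm (modulus_mul_self_le a) (le_modulus_mul_self a)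

theorem modulus_mul (a b : Complexification E) : modulus (a * b) = modulus a * modulus b := by
  refine PhiAlgebra.eq_of_mul_self_eq (modulus_nonneg _)
    (mul_nonneg (modulus_nonneg _) (modulus_nonneg _)) ?_
  rw [mul_mul_mul_comm, modulus_mul_self, modulus_mul_self, modulus_mul_self, mul_re, mul_im]
  ring

theorem modulus_one : modulus (1 : Complexification E) = 1 :=
  (modulus_ofReal (1 : E)).trans (abs_of_nonneg zero_le_one)

theorem modulus_pow (a : Complexification E) (n : ℕ) : modulus (a ^ n) = modulus a ^ n := by
  induction n with
  | zero => rw [pow_zero, pow_zero, modulus_one]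
  | succ n ih => rw [pow_succ, pow_succ, modulus_mul, ih]

end CommRing

end Complexification

namespace PhiAlgebra

section UnitComponent

variable {E : Type*} [ConditionallyCompleteLattice E] [CommRing E]

/-- The component of `1` in the band generated by `v ≥ 0`. -/
noncomputable def unitComponent (v : E) : E := ⨆ n : ℕ, (n • v) ⊓ 1

theorem isLUB_unitComponent (v : E) :
    IsLUB (Set.range fun n : ℕ => (n • v) ⊓ 1) (unitComponent v) :=
  isLUB_ciSup ⟨1, Set.forall_mem_range.2 fun _ => inf_le_right⟩

theorem nsmul_inf_one_le_unitComponent (v : E) (n : ℕ) : (n • v) ⊓ 1 ≤ unitComponent v :=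
  (isLUB_unitComponent v).1 (Set.mem_range_self n)

theorem unitComponent_le_one (v : E) : unitComponent v ≤ 1 :=
  (isLUB_unitComponent v).2 (Set.forall_mem_range.2 fun _ => inf_le_right)

theorem unitComponent_mono [IsOrderedAddMonoid E] : Monotone (unitComponent : E → E) :=
  fun v w h => (isLUB_unitComponent v).2 <| Set.forall_mem_range.2 fun n =>
    (inf_le_inf_right _ (nsmul_le_nsmul_right h n)).trans (nsmul_inf_one_le_unitComponent w n)

variable [Algebra ℝ E] [IsOrderedAddMonoid E] [IsPhiAlgebra E]

theorem unitComponent_nonneg (v : E) : 0 ≤ unitComponent v := by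
  simpa only [zero_smul, inf_eq_left.2 (zero_le_one E)] using nsmul_inf_one_le_unitComponent v 0

theorem mul_one_sub_unitComponent {v : E} (hv : 0 ≤ v) : v * (1 - unitComponent v) = 0 := by
  have hp : 0 ≤ 1 - unitComponent v := sub_nonneg.2 (unitComponent_le_one v)
  refine le_antisymm (nonpos_of_forall_nsmul_le _ 1 fun n => ?_) (mul_nonneg hv hp)
  have hnv : 0 ≤ n • v := nsmul_nonneg hv n
  have hle : 1 - unitComponent v ≤ (1 - n • v)⁺ := by
    refine (sub_le_sub_left (nsmul_inf_one_le_unitComponent v n) 1).trans_eq ?_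
    rw [sub_inf, sub_self, posPart_def]
  calc n • (v * (1 - unitComponent v)) = (1 - unitComponent v) * n • v := by
        rw [← smul_mul_assoc, mul_comm]
    _ ≤ (1 - n • v)⁺ * n • v := mul_le_mul_of_nonneg_right hle hnv
    _ ≤ (1 - n • v)⁺ * 1 := posPart_sub_mul_le 1 _
    _ ≤ 1 := (mul_one _).trans_le (sup_le (sub_le_self 1 hnv) (zero_le_one E))

theorem eq_zero_of_forall_mul_unitComponent_eq_zero {d y : E} (hd : IsWeakOrderUnit d)
    (hy : 0 ≤ y) (h : ∀ k : ℕ, y * unitComponent (k • d - 1)⁺ = 0) : y = 0 := by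
  have hpos (k : ℕ) : y * (k • d - 1)⁺ = 0 := by
    have hband := mul_one_sub_unitComponent (posPart_nonneg (k • d - 1))
    rw [mul_sub, mul_one, sub_eq_zero] at hband
    rw [hband, mul_left_comm, h k, mul_zero]
  have hyd : d * y = 0 := by
    refine le_antisymm (nonpos_of_forall_nsmul_le _ y fun k => sub_nonpos.1 ?_)
      (mul_nonneg hd.1 hy)
    calc k • (d * y) - y = y * (k • d - 1) := by rw [mul_sub, mul_one, mul_smul_comm, mul_comm]
      _ ≤ y * (k • d - 1)⁺ := mul_le_mul_of_nonneg_left (le_posPart _) hy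
      _ = 0 := hpos k
  refine hd.2 y ?_
  rwa [abs_of_nonneg hy, inf_eq_zero_iff_mul_eq_zero hd.1 hy]

theorem posPart_one_sub_mul_eq_zero {c w : E} (hc : c * c = c) (h : c ≤ w * c) :
    (1 - w)⁺ * c = 0 := by
  set y := (1 - w)⁺
  have hyw : y * (1 - w) = y * y := posPart_mul_self (1 - w)
  refine eq_zero_of_mul_self_eq_zero (le_antisymm ?_ (mul_self_nonneg _))
  calc y * c * (y * c) = y * y * (c * c) := mul_mul_mul_comm ..
    _ = y * (c - w * c) := by rw [hc, ← hyw, mul_assoc, sub_mul, one_mul]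
    _ ≤ 0 := mul_nonpos_of_nonneg_of_nonpos (posPart_nonneg _) (sub_nonpos.2 h)

theorem exists_forall_succ_nsmul_sub_le [IsLaterallyComplete E] {q : ℕ → E} (hq : Monotone q)
    (hmul : ∀ i j, i ≤ j → q i * q j = q i) :
    ∃ u, ∀ k : ℕ, (k + 1) • (q (k + 1) - q k) ≤ u := by
  have hpos (k : ℕ) : 0 ≤ (k + 1) • (q (k + 1) - q k) :=
    nsmul_nonneg (sub_nonneg.2 (hq k.le_succ)) _
  have hdisj {i j : ℕ} (hij : i < j) :
      (i + 1) • (q (i + 1) - q i) ⊓ (j + 1) • (q (j + 1) - q j) = 0 := by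
    rw [inf_eq_zero_iff_mul_eq_zero (hpos i) (hpos j), smul_mul_smul_comm]
    simp only [sub_mul, mul_sub, hmul _ _ hij, hmul _ _ hij.le,
      hmul _ _ (Nat.succ_le_succ hij.le), hmul _ _ (hij.le.trans j.le_succ), sub_self, smul_zero]
  obtain ⟨u, hu⟩ := IsLaterallyComplete.exists_isLUB
    (Set.range fun k : ℕ => (k + 1) • (q (k + 1) - q k)) (Set.range_nonempty _)
    (Set.forall_mem_range.2 hpos) <| by
      rintro _ ⟨i, rfl⟩ _ ⟨j, rfl⟩ hne
      rcases lt_trichotomy i j with hij | rfl | hij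
      · exact hdisj hij
      · exact absurd rfl hne
      · exact inf_comm (_ : E) _ ▸ hdisj hij
  exact ⟨u, fun k => hu.1 (Set.mem_range_self k)⟩

variable [IsOrderedModule ℝ E]

theorem mul_unitComponent_eq_zero {y v : E} (hy : 0 ≤ y) (h : y * v = 0) :
    y * unitComponent v = 0 := by
  refine le_antisymm ((isLUB_mul_left hy (Set.range_nonempty _) (isLUB_unitComponent v)).2 ?_)
    (mul_nonneg hy (unitComponent_nonneg v))
  refine Set.forall_mem_image.2 (Set.forall_mem_range.2 fun n => ?_)
  calc y * ((n • v) ⊓ 1) ≤ y * n • v := mul_le_mul_of_nonneg_left inf_le_left hy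
    _ = 0 := by rw [mul_smul_comm, h, smul_zero]

theorem mul_unitComponent_posPart_nonneg (x : E) : 0 ≤ x * unitComponent x⁺ := by
  have hneg : x⁻ * unitComponent x⁺ = 0 :=
    mul_unitComponent_eq_zero (negPart_nonneg x) (negPart_mul_posPart x)
  calc 0 ≤ x⁺ * unitComponent x⁺ := mul_nonneg (posPart_nonneg x) (unitComponent_nonneg _)
    _ = (x⁺ - x⁻) * unitComponent x⁺ := by rw [sub_mul, hneg, sub_zero]
    _ = x * unitComponent x⁺ := by rw [posPart_sub_negPart]

theorem unitComponent_mul_unitComponent_of_le {v w : E} (hv : 0 ≤ v) (h : v ≤ w) :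
    unitComponent v * unitComponent w = unitComponent v := by
  have hw : 0 ≤ 1 - unitComponent w := sub_nonneg.2 (unitComponent_le_one w)
  have hvw : (1 - unitComponent w) * v = 0 := by
    refine le_antisymm ?_ (mul_nonneg hw hv)
    rw [← mul_one_sub_unitComponent (hv.trans h), mul_comm w]
    exact mul_le_mul_of_nonneg_left h hw
  have hp := mul_unitComponent_eq_zero hw hvw
  rw [sub_mul, one_mul, sub_eq_zero] at hp
  rw [mul_comm, ← hp]

/-- On the component `c` of `1` where `1 / (k + 1) < d ≤ 1 / k`, the element `(k + 1) c` inverts `d`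
up to a factor in `[1, (k + 1) / k]`. Lateral completeness glues these elements together. -/
theorem exists_one_le_mul_of_isWeakOrderUnit [IsLaterallyComplete E] {d : E}
    (hd : IsWeakOrderUnit d) : ∃ u, 1 ≤ u * d := by
  set q : ℕ → E := fun k => unitComponent (k • d - 1)⁺
  have hlevel : Monotone fun k : ℕ => (k • d - 1)⁺ := fun i j hij =>
    posPart_mono (sub_le_sub_right (nsmul_le_nsmul_left hd.1 hij) 1)
  have hq : Monotone q := unitComponent_mono.comp hlevel
  have hmul (i j : ℕ) (hij : i ≤ j) : q i * q j = q i :=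
    unitComponent_mul_unitComponent_of_le (posPart_nonneg _) (hlevel hij)
  obtain ⟨u, hu⟩ := exists_forall_succ_nsmul_sub_le hq hmul
  have hstep (k : ℕ) : (1 - u * d)⁺ * (q (k + 1) - q k) = 0 := by
    set c := q (k + 1) - q k with hc_def
    have hc : 0 ≤ c := sub_nonneg.2 (hq k.le_succ)
    have hqc : q (k + 1) * c = c := by
      rw [hc_def, mul_sub, hmul _ _ le_rfl, mul_comm, hmul _ _ k.le_succ]
    have hcc : c * c = c := IsIdempotentElem.sub (hmul k k le_rfl) (hmul _ _ le_rfl)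
      (hmul _ _ k.le_succ) ((mul_comm ..).trans (hmul _ _ k.le_succ))
    have hkd : c ≤ (k + 1) • d * c := by
      have h := mul_nonneg (mul_unitComponent_posPart_nonneg ((k + 1) • d - 1)) hc
      rwa [mul_assoc, hqc, sub_mul, one_mul, sub_nonneg] at h
    refine posPart_one_sub_mul_eq_zero hcc ?_
    calc c ≤ (k + 1) • d * (c * c) := hkd.trans_eq (by rw [hcc])
      _ = (k + 1) • c * (d * c) := by simp only [smul_mul_assoc, mul_left_comm d c c]
      _ ≤ u * (d * c) := mul_le_mul_of_nonneg_right (hu k) (mul_nonneg hd.1 hc)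
      _ = u * d * c := (mul_assoc ..).symm
  have hzero (k : ℕ) : (1 - u * d)⁺ * q k = 0 := by
    induction k with
    | zero =>
      refine mul_unitComponent_eq_zero (posPart_nonneg _) ?_
      rw [zero_smul, zero_sub, posPart_neg, negPart_eq_zero.2 (zero_le_one E), mul_zero]
    | succ k ih => rw [← sub_add_cancel (q (k + 1)) (q k), mul_add, hstep, ih, add_zero]
  exact ⟨u, sub_nonpos.1 (posPart_eq_zero.1
    (eq_zero_of_forall_mul_unitComponent_eq_zero hd (posPart_nonneg _) hzero))⟩

theorem inv_sq_smul_posPart_natCast_sub_mul_le_one {n : ℕ} (hn : 0 < n) {w : E} (hw : 0 ≤ w) :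
    ((n : ℝ) ^ 2)⁻¹ • ((n : E) - w)⁺ * w ≤ 1 := by
  have hn0 : (0 : E) ≤ n := n.cast_nonneg
  have hle : ((n : E) - w)⁺ * w ≤ (n : E) * n :=
    (posPart_sub_mul_le _ w).trans <|
      mul_le_mul_of_nonneg_right (sup_le (sub_le_self _ hw) hn0) hn0
  calc ((n : ℝ) ^ 2)⁻¹ • ((n : E) - w)⁺ * w ≤ ((n : ℝ) ^ 2)⁻¹ • ((n : E) * n) := by
        rw [smul_mul_assoc]
        exact smul_le_smul_of_nonneg_left hle (by positivity)
    _ = 1 := by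
        rw [inv_smul_eq_iff₀ (by positivity), Algebra.smul_def, mul_one, map_pow, map_natCast, sq]

theorem isUnit_of_one_le {w : E} (hw : 1 ≤ w) : IsUnit w := by
  have hw0 : 0 ≤ w := (zero_le_one E).trans hw
  set A : Set E := {s | 0 ≤ s ∧ s * w ≤ 1}
  have hzero : (0 : E) ∈ A := ⟨le_rfl, (zero_mul w).trans_le (zero_le_one E)⟩
  have hLUB : IsLUB A (sSup A) := isLUB_csSup ⟨0, hzero⟩
    ⟨1, fun s hs => (le_mul_of_one_le_right hs.1 hw).trans hs.2⟩
  set b := sSup A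
  have hbw : w * b ≤ 1 := (isLUB_mul_left hw0 ⟨0, hzero⟩ hLUB).2 <|
    Set.forall_mem_image.2 fun s hs => (mul_comm w s).trans_le hs.2
  set y := 1 - w * b with hy_def
  have hy : 0 ≤ y := sub_nonneg.2 hbw
  have hyA {t : E} (ht : t ∈ A) : y * t ≤ 0 := by
    refine (add_le_iff_nonpos_right b).1 (hLUB.1 ⟨?_, ?_⟩)
    · exact add_nonneg (hLUB.1 hzero) (mul_nonneg hy ht.1)
    · calc (b + y * t) * w = w * b + y * (t * w) := by ring
        _ ≤ w * b + y * 1 := add_le_add_right (mul_le_mul_of_nonneg_left ht.2 hy) _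
        _ = 1 := by rw [hy_def]; ring
  have hyw : y ≤ 0 := nonpos_of_forall_nsmul_le _ (y * w) fun n => by
    rcases n.eq_zero_or_pos with rfl | hn
    · exact (zero_smul ℕ _).trans_le (mul_nonneg hy hw0)
    have ht : y * (((n : ℝ) ^ 2)⁻¹ • ((n : E) - w)⁺) ≤ 0 := hyA
      ⟨smul_nonneg (by positivity) (posPart_nonneg _),
        inv_sq_smul_posPart_natCast_sub_mul_le_one hn hw0⟩
    have hpos : y * ((n : E) - w)⁺ ≤ 0 := by
      rw [mul_smul_comm] at ht
      exact (smul_nonpos_iff_nonpos_of_pos_left (by positivity)).1 ht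
    calc n • y = y * (n - w) + y * w := by rw [nsmul_eq_mul]; ring
      _ ≤ y * (n - w)⁺ + y * w := by gcongr; exact le_posPart _
      _ ≤ y * w := add_le_of_nonpos_left hpos
  exact IsUnit.of_mul_eq_one b (le_antisymm hbw (sub_nonpos.1 hyw))

end UnitComponent

end PhiAlgebra

theorem IsWeakOrderUnit.isUnit {E : Type*} [ConditionallyCompleteLattice E] [CommRing E]
    [Algebra ℝ E] [IsOrderedAddMonoid E] [IsOrderedModule ℝ E] [IsPhiAlgebra E]
    [IsLaterallyComplete E] {d : E} (hd : IsWeakOrderUnit d) : IsUnit d := by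
  obtain ⟨u, hu⟩ := PhiAlgebra.exists_one_le_mul_of_isWeakOrderUnit hd
  exact isUnit_of_mul_isUnit_right (PhiAlgebra.isUnit_of_one_le hu)

section WeakOrderUnit

variable {E : Type*} [Lattice E] [AddCommGroup E] [IsOrderedAddMonoid E]

theorem IsWeakOrderUnit.mono {u v : E} (hu : IsWeakOrderUnit u) (h : u ≤ v) :
    IsWeakOrderUnit v :=
  ⟨hu.1.trans h, fun x hx => hu.2 x <|
    le_antisymm ((inf_le_inf_right _ h).trans_eq hx) (le_inf hu.1 (abs_nonneg x))⟩

theorem StrictlyBelow.isWeakOrderUnit_sub {x y : E}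
    (h : StrictlyBelow x y) : IsWeakOrderUnit (y - x) := by
  have hneg : (y - x)⁻ = 0 := h.2 _ <| by
    rw [abs_of_nonneg (negPart_nonneg _), posPart_inf_negPart_eq_zero]
  rwa [StrictlyBelow, posPart_eq_self.2 (negPart_eq_zero.1 hneg)] at h

end WeakOrderUnit

/-- The sequence `p` decreases to `0`, written `p n ↓ 0`. -/
def DecreasesToZero {E : Type*} [Lattice E] [AddCommGroup E] (p : ℕ → E) : Prop :=
  Antitone p ∧ IsGLB (Set.range p) 0

namespace DecreasesToZero

section AddCommGroup

variable {E : Type*} [Lattice E] [AddCommGroup E] {p q : ℕ → E}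

theorem nonpos_of_forall_le (hp : DecreasesToZero p) {z : E} (h : ∀ n, z ≤ p n) : z ≤ 0 :=
  hp.2.2 (Set.forall_mem_range.2 h)

theorem nonneg (hp : DecreasesToZero p) (n : ℕ) : 0 ≤ p n := hp.2.1 (Set.mem_range_self n)

theorem add [IsOrderedAddMonoid E] (hp : DecreasesToZero p) (hq : DecreasesToZero q) :
    DecreasesToZero fun n => p n + q n := by
  refine ⟨fun i j h => add_le_add (hp.1 h) (hq.1 h),
    Set.forall_mem_range.2 fun n => add_nonneg (hp.nonneg n) (hq.nonneg n), fun z hz => ?_⟩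
  refine hp.nonpos_of_forall_le fun m => sub_nonpos.1 <| hq.nonpos_of_forall_le fun n => ?_
  rw [sub_le_iff_le_add']
  exact (Set.forall_mem_range.1 hz (max m n)).trans
    (add_le_add (hp.1 (le_max_left m n)) (hq.1 (le_max_right m n)))

end AddCommGroup

section CommRing

variable {E : Type*} [Lattice E] [CommRing E] [Algebra ℝ E] [IsOrderedAddMonoid E] [IsPhiAlgebra E]
  [IsArchimedeanLattice E]

theorem mul_left [IsOrderedModule ℝ E] {p : ℕ → E} (hp : DecreasesToZero p) {c : E}
    (hc : 0 ≤ c) : DecreasesToZero fun n => c * p n := by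
  refine ⟨fun i j h => mul_le_mul_of_nonneg_left (hp.1 h) hc, ?_⟩
  have h := PhiAlgebra.isGLB_mul_left hc (Set.range_nonempty p) hp.2
  rwa [← Set.range_comp] at h

/-- A positive lower bound `z` of the powers satisfies
`n z (1 - r) ≤ (1 + r + ⋯ + r ^ (n - 1)) (1 - r) ≤ 1` for every `n`. -/
theorem pow {r : E} (hr : 0 ≤ r) (h : StrictlyBelow r 1) : DecreasesToZero fun n => r ^ n := by
  have hd := h.isWeakOrderUnit_sub
  refine ⟨pow_right_anti₀ hr (sub_nonneg.1 hd.1),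
    Set.forall_mem_range.2 (pow_nonneg hr), fun z hz => posPart_eq_zero.1 <| hd.2 _ ?_⟩
  have hzr (n : ℕ) : z⁺ ≤ r ^ n := sup_le (Set.forall_mem_range.1 hz n) (pow_nonneg hr n)
  rw [abs_of_nonneg (posPart_nonneg z),
    PhiAlgebra.inf_eq_zero_iff_mul_eq_zero hd.1 (posPart_nonneg z)]
  refine le_antisymm (IsArchimedeanLattice.nonpos_of_forall_nsmul_le _ 1 fun n => ?_)
    (mul_nonneg hd.1 (posPart_nonneg z))
  calc n • ((1 - r) * z⁺) = n • z⁺ * (1 - r) := by rw [← mul_smul_comm, mul_comm]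
    _ ≤ (∑ k ∈ Finset.range n, r ^ k) * (1 - r) := by
        refine mul_le_mul_of_nonneg_right ?_ hd.1
        simpa only [Finset.card_range] using
          Finset.card_nsmul_le_sum (Finset.range n) (r ^ ·) z⁺ fun k _ => hzr k
    _ = 1 - r ^ n := geom_sum_mul_neg r n
    _ ≤ 1 := sub_le_self 1 (pow_nonneg hr n)

theorem strictlyBelow_one [IsOrderedModule ℝ E] {p : ℕ → E} (hp : DecreasesToZero p) {r : E}
    (hr : 0 ≤ r) (h : ∀ n, r ^ (n + 1) ≤ p n) : StrictlyBelow r 1 := by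
  refine ⟨posPart_nonneg _, fun x hx => ?_⟩
  have hxr : |x| ≤ r * |x| := by
    rw [← sub_nonpos, ← one_sub_mul, ← PhiAlgebra.mul_eq_zero_of_inf_eq_zero hx]
    exact mul_le_mul_of_nonneg_right (le_posPart _) (abs_nonneg x)
  have hpow (n : ℕ) : |x| ≤ r ^ n * |x| := by
    induction n with
    | zero => rw [pow_zero, one_mul]
    | succ n ih =>
      rw [pow_succ, mul_assoc]
      exact ih.trans (mul_le_mul_of_nonneg_left hxr (pow_nonneg hr n))
  refine eq_zero_of_abs_nonpos <| (hp.mul_left (abs_nonneg x)).nonpos_of_forall_le fun n => ?_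
  rw [mul_comm]
  exact (hpow (n + 1)).trans (mul_le_mul_of_nonneg_right (h n) (abs_nonneg x))

end CommRing

end DecreasesToZero

namespace Complexification

section Convergence

variable {E : Type*} [ConditionallyCompleteLattice E] [Ring E] [Module ℝ E]
  [IsOrderedAddMonoid E] [IsOrderedModule ℝ E] {x : ℕ → Complexification E}

theorem OrderConvergesTo.unique {l l' : Complexification E} (h : OrderConvergesTo x l)
    (h' : OrderConvergesTo x l') : l = l' := by
  obtain ⟨p, hp_anti, hp_glb, hp⟩ := h
  obtain ⟨q, hq_anti, hq_glb, hq⟩ := h'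
  have hpq : DecreasesToZero fun n => p n + q n :=
    DecreasesToZero.add ⟨hp_anti, hp_glb⟩ ⟨hq_anti, hq_glb⟩
  refine sub_eq_zero.1 <| eq_zero_of_modulus_nonpos <| hpq.nonpos_of_forall_le fun n => ?_
  calc modulus (l - l') ≤ modulus (l - x n) + modulus (x n - l') := modulus_sub_le ..
    _ ≤ p n + q n := add_le_add (modulus_sub_comm l (x n) ▸ hp n) (hq n)

theorem HasOrderSum.exists_modulus_succ_le {s : Complexification E} (h : HasOrderSum x s) :
    ∃ q : ℕ → E, DecreasesToZero q ∧ ∀ n, modulus (x (n + 1)) ≤ q n := by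
  obtain ⟨p, hp_anti, hp_glb, hp⟩ := h
  refine ⟨_, DecreasesToZero.add ⟨hp_anti, hp_glb⟩ ⟨hp_anti, hp_glb⟩, fun n => ?_⟩
  set S : ℕ → Complexification E := fun m => ∑ k ∈ Finset.range (m + 1), x k
  calc modulus (x (n + 1)) = modulus (S (n + 1) - S n) :=
        congrArg modulus (Finset.sum_range_succ_sub_sum x).symm
    _ ≤ modulus (S (n + 1) - s) + modulus (s - S n) := modulus_sub_le ..
    _ ≤ p n + p n := add_le_add ((hp (n + 1)).trans (hp_anti n.le_succ))
        (modulus_sub_comm s (S n) ▸ hp n)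

end Convergence

section CommRing

variable {E : Type*} [CommRing E]

instance : CommRing (Complexification E) where
  mul_comm a b := by ext <;> simp only [mul_re, mul_im] <;> ring

/-- `ofReal` as a ring homomorphism. -/
def ofRealHom : E →+* Complexification E where
  toFun := ofReal
  map_one' := rfl
  map_mul' f g := by ext <;> simp [ofReal]
  map_zero' := rfl
  map_add' f g := by ext <;> simp [ofReal]

/-- The complex conjugate `f - ig` of `f + ig`. -/
def conj (a : Complexification E) : Complexification E := ⟨a.re, -a.im⟩

variable [ConditionallyCompleteLattice E] [Algebra ℝ E] [IsOrderedAddMonoid E]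
  [IsOrderedModule ℝ E] [IsPhiAlgebra E]

theorem mul_conj (a : Complexification E) : a * conj a = ofReal (modulus a * modulus a) := by
  rw [modulus_mul_self]
  ext
  · simp only [mul_re, conj, ofReal, mul_neg, sub_neg_eq_add]
  · simp only [mul_im, conj, ofReal]
    ring

theorem isUnit_of_isUnit_modulus {a : Complexification E} (h : IsUnit (modulus a)) : IsUnit a := by
  refine isUnit_of_mul_isUnit_left (y := conj a) ?_
  rw [mul_conj]
  exact (h.mul h).map ofRealHom

theorem one_sub_modulus_le (a : Complexification E) : 1 - modulus a ≤ modulus (1 - a) := by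
  have h := modulus_add_le (1 - a) a
  rwa [sub_add_cancel, modulus_one, ← sub_le_iff_le_add] at h

theorem isUnit_one_sub [IsLaterallyComplete E] {a : Complexification E}
    (h : StrictlyBelow (modulus a) 1) : IsUnit (1 - a) :=
  isUnit_of_isUnit_modulus (h.isWeakOrderUnit_sub.mono (one_sub_modulus_le a)).isUnit

theorem hasOrderSum_pow {a : Complexification E} {u : (Complexification E)ˣ} (hu : ↑u = 1 - a)
    (h : StrictlyBelow (modulus a) 1) : HasOrderSum (fun n => a ^ n) ↑u⁻¹ := by
  obtain ⟨hanti, hglb⟩ := (DecreasesToZero.pow (modulus_nonneg a) h).mul_left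
    (modulus_nonneg (a * (↑u⁻¹ : Complexification E)))
  refine ⟨_, hanti, hglb, fun m => ?_⟩
  have hsum : ∑ n ∈ Finset.range (m + 1), a ^ n = (1 - a ^ (m + 1)) * ↑u⁻¹ := by
    rw [Units.eq_mul_inv_iff_mul_eq, hu, geom_sum_mul_neg]
  have herror : ∑ n ∈ Finset.range (m + 1), a ^ n - ↑u⁻¹ = -(a * ↑u⁻¹ * a ^ m) := by
    rw [hsum]
    ring
  rw [herror, modulus_neg, modulus_mul, modulus_pow]

theorem ofReal_modulus_pow (a : Complexification E) (n : ℕ) :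
    ofReal (modulus (a ^ n)) = ofReal (modulus a) ^ n :=
  (congrArg ofReal (modulus_pow a n)).trans (map_pow ofRealHom (modulus a) n)

theorem absConvergesInOrder_pow [IsLaterallyComplete E] {a : Complexification E}
    (h : StrictlyBelow (modulus a) 1) : AbsConvergesInOrder fun n => a ^ n := by
  have hmod : StrictlyBelow (modulus (ofReal (modulus a))) 1 := by
    rwa [modulus_ofReal, abs_of_nonneg (modulus_nonneg a)]
  obtain ⟨u, hu⟩ := isUnit_one_sub hmod
  refine ⟨↑u⁻¹, ?_⟩
  simp only [ofReal_modulus_pow]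
  exact hasOrderSum_pow hu hmod

theorem strictlyBelow_of_absConvergesInOrder_pow {a : Complexification E}
    (h : AbsConvergesInOrder fun n => a ^ n) : StrictlyBelow (modulus a) 1 := by
  obtain ⟨s, hs⟩ := h
  obtain ⟨q, hq, hle⟩ := hs.exists_modulus_succ_le
  refine hq.strictlyBelow_one (modulus_nonneg a) fun n => ?_
  rw [← modulus_pow, ← abs_of_nonneg (modulus_nonneg (a ^ (n + 1))), ← modulus_ofReal]
  exact hle n

end CommRing

end Complexification

theorem lemma3p4 {E : Type*} [ConditionallyCompleteLattice E] [Ring E] [Algebra ℝ E]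
    [IsOrderedAddMonoid E] [IsOrderedModule ℝ E] [IsUniversallyComplete E] [IsPhiAlgebra E]
    (a : Complexification E) :
    (Complexification.AbsConvergesInOrder (fun n : ℕ => a ^ n) ↔
      StrictlyBelow (Complexification.modulus a) (1 : E)) ∧
    (StrictlyBelow (Complexification.modulus a) (1 : E) →
      ∃ u : (Complexification E)ˣ, (u : Complexification E) = 1 - a ∧
        ∀ s : Complexification E,
          Complexification.HasOrderSum (fun n : ℕ => a ^ n) s ↔
            s = ((u⁻¹ : (Complexification E)ˣ) : Complexification E)) := by
  let : CommRing E := { ‹Ring E› with mul_comm := fun x y => (PhiAlgebra.commute x y).eq }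
  refine ⟨⟨Complexification.strictlyBelow_of_absConvergesInOrder_pow,
    Complexification.absConvergesInOrder_pow⟩, fun h => ?_⟩
  obtain ⟨u, hu⟩ := Complexification.isUnit_one_sub h
  have hsum := Complexification.hasOrderSum_pow hu h
  exact ⟨u, hu, fun s => ⟨fun hs => hs.unique hsum, fun hs => hs ▸ hsum⟩⟩
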